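/- Let $k$ be an algebraically closed field, let $r \ge 2$ and $m \ge 3$ be integers, and let $P_1, \dots, P_{3m}$ be distinct points of $\mathbf{P}^r(k)$. For a point $P = (p_0 : \cdots : p_r)$ with first nonzero coordinate $p_i$, let $\mathrm{ev}_P$ denote the linear form $f \mapsto f(p_0, \dots, p_r)/p_i^m$ on the space of homogeneous forms of degree $m$ in $r+1$ variables over $k$. Assume that - the points are $m$-linked, that is, $\mathrm{ev}_{P_1}, \dots, \mathrm{ev}_{P_{3m}}$ are linearly dependent; - no $m+2$ of the points are collinear; - no $2m+2$ of the points lie on a plane conic (the zero locus, possibly reducible, of a nonzero quadratic form in a plane of $\mathbf{P}^r$). Then the points are coplanar. More precisely, there are a plane $\Pi \subset \mathbf{P}^r$ containing all the $P_i$ and, in homogeneous coordinates on $\Pi$, nonzero ternary forms $F$ of degree $3$ and $G$ of degree $m$ over $k$ without common irreducible factor (so that the plane curves $F = 0$ and $G = 0$ have no common component) such that $$\{P_1, \dots, P_{3m}\} = \{F = 0\} \cap \{G = 0\}.$$ -/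

import Mathlib

open scoped LinearAlgebra.Projectivization

noncomputable section

namespace LinkedPoints

/-- The set of rational points of the projective space of dimension `r` over `k`. -/
abbrev PSpace (k : Type*) [Field k] (r : ℕ) : Type _ := ℙ k (Fin (r + 1) → k)

/-- The space of forms (homogeneous polynomials) of degree `m` in `r + 1` variables. -/
abbrev Forms (k : Type*) [Field k] (m r : ℕ) : Submodule k (MvPolynomial (Fin (r + 1)) k) :=
  MvPolynomial.homogeneousSubmodule (Fin (r + 1)) k m

open Classical in
/-- The first nonzero coordinate of a vector (and `0` for the zero vector). -/
def firstCoord {k : Type*} [Field k] {r : ℕ} (v : Fin (r + 1) → k) : k :=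
  if h : (Finset.univ.filter (fun i => v i ≠ 0)).Nonempty then v (Finset.min' _ h) else 0

/-- The evaluation map at the point `p = (p₀ : ⋯ : pᵣ)` on forms of degree `m`: it sends `f` to
`f (p₀, …, pᵣ) / pᵢ ^ m`, where `pᵢ` is the first nonzero homogeneous coordinate of `p`. -/
def ev {k : Type*} [Field k] {r : ℕ} (m : ℕ) (p : PSpace k r) : Forms k m r →ₗ[k] k where
  toFun f := MvPolynomial.eval p.rep (f : MvPolynomial (Fin (r + 1)) k) / firstCoord p.rep ^ m
  map_add' f g := by simp [add_div]
  map_smul' c f := by simp [MvPolynomial.smul_eval, mul_div_assoc]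

lemma firstCoord_ne_zero {k : Type*} [Field k] {r : ℕ} (v : Fin (r + 1) → k) (hv : v ≠ 0) :
    firstCoord v ≠ 0 := by
  classical
  obtain ⟨i, hi⟩ := Function.ne_iff.mp hv
  have h : (Finset.univ.filter (fun i => v i ≠ 0)).Nonempty := ⟨i, by simpa using hi⟩
  have h2 := (Finset.mem_filter.mp (Finset.min'_mem _ h)).2
  unfold firstCoord
  split_ifs
  convert h2

lemma firstCoord_smul {k : Type*} [Field k] {r : ℕ} (a : k) (ha : a ≠ 0) (v : Fin (r + 1) → k) :
    firstCoord (a • v) = a * firstCoord v := by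
  classical
  have hs : (Finset.univ.filter (fun i => (a • v) i ≠ 0)) =
      Finset.univ.filter (fun i => v i ≠ 0) := by
    ext i
    simp [ha]
  unfold firstCoord
  by_cases h : (Finset.univ.filter (fun i => v i ≠ 0)).Nonempty
  · rw [dif_pos (by convert h), dif_pos (by convert h), Pi.smul_apply, smul_eq_mul]
    congr 3
  · rw [dif_neg (by convert h), dif_neg (by convert h), mul_zero]

lemma eval_smul_vec {k : Type*} [Field k] {r m : ℕ} (a : k) (v : Fin (r + 1) → k)
    {f : MvPolynomial (Fin (r + 1)) k} (hf : f.IsHomogeneous m) :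
    MvPolynomial.eval (a • v) f = a ^ m * MvPolynomial.eval v f := by
  rw [MvPolynomial.eval_eq, MvPolynomial.eval_eq, Finset.mul_sum]
  refine Finset.sum_congr rfl fun d hd => ?_
  have hdeg : ∑ i ∈ d.support, d i = m := by
    have := hf (MvPolynomial.mem_support_iff.mp hd)
    rw [← this, Finsupp.weight_apply, Finsupp.sum]
    simp
  simp only [Pi.smul_apply, smul_eq_mul, mul_pow, Finset.prod_mul_distrib]
  rw [Finset.prod_pow_eq_pow_sum, hdeg]
  ring

/-- The evaluation map can be computed with any homogeneous coordinate vector of the point. -/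
lemma ev_mk {k : Type*} [Field k] {r m : ℕ} (v : Fin (r + 1) → k) (hv : v ≠ 0)
    (f : Forms k m r) :
    ev m (Projectivization.mk k v hv) f =
      MvPolynomial.eval v (f : MvPolynomial (Fin (r + 1)) k) / firstCoord v ^ m := by
  obtain ⟨a, ha⟩ := Projectivization.exists_smul_eq_mk_rep k v hv
  have hf : (f : MvPolynomial (Fin (r + 1)) k).IsHomogeneous m := f.2
  have ha0 : (a : k) ≠ 0 := a.ne_zero
  change MvPolynomial.eval (Projectivization.mk k v hv).rep (f : MvPolynomial (Fin (r + 1)) k) /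
    firstCoord (Projectivization.mk k v hv).rep ^ m = _
  rw [← ha, Units.smul_def, eval_smul_vec (a : k) v hf, firstCoord_smul (a : k) ha0, mul_pow,
    mul_div_mul_left _ _ (pow_ne_zero _ ha0)]

/-- A family of points is in `m`-general position if the evaluation maps on forms of degree `m`
at these points are linearly independent. -/
def IsGeneral {k : Type*} [Field k] {r : ℕ} {ι : Type*} (m : ℕ) (P : ι → PSpace k r) : Prop :=
  LinearIndependent k (fun i => ev m (P i))

/-- A family of points is `m`-linked if it is not in `m`-general position. -/
def IsLinked {k : Type*} [Field k] {r : ℕ} {ι : Type*} (m : ℕ) (P : ι → PSpace k r) : Prop :=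
  ¬ IsGeneral m P

/-- The projective linear subspace attached to a vector subspace `W` (a line if `W` has dimension
`2`, a plane if `W` has dimension `3`). -/
def linearSubspace {k : Type*} [Field k] {r : ℕ} (W : Submodule k (Fin (r + 1) → k)) :
    Set (PSpace k r) :=
  {p | p.submodule ≤ W}

/-- The points of `S` lie on a common line. -/
def AreCollinear {k : Type*} [Field k] {r : ℕ} (S : Set (PSpace k r)) : Prop :=
  ∃ W : Submodule k (Fin (r + 1) → k), Module.finrank k W = 2 ∧ S ⊆ linearSubspace W

/-- The curve of equation `F = 0` in the plane attached to `W`, where `F` is a ternary form and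
`φ` is a system of homogeneous coordinates on this plane. For a form `F`, the condition does not
depend on the vector representing the point `p`. -/
def planeCurve {k : Type*} [Field k] {r : ℕ} {W : Submodule k (Fin (r + 1) → k)}
    (φ : W ≃ₗ[k] (Fin 3 → k)) (F : MvPolynomial (Fin 3) k) : Set (PSpace k r) :=
  {p | ∃ h : p.rep ∈ W, MvPolynomial.eval (φ ⟨p.rep, h⟩) F = 0}

/-- Membership in a plane curve can be tested on any homogeneous coordinate vector. -/
lemma mk_mem_planeCurve {k : Type*} [Field k] {r d : ℕ} {W : Submodule k (Fin (r + 1) → k)}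
    (φ : W ≃ₗ[k] (Fin 3 → k)) {F : MvPolynomial (Fin 3) k} (hF : F.IsHomogeneous d)
    (v : W) (hv : (v : Fin (r + 1) → k) ≠ 0) :
    Projectivization.mk k (v : Fin (r + 1) → k) hv ∈ planeCurve φ F ↔
      MvPolynomial.eval (φ v) F = 0 := by
  obtain ⟨a, ha⟩ := Projectivization.exists_smul_eq_mk_rep k (v : Fin (r + 1) → k) hv
  have ha0 : (a : k) ≠ 0 := a.ne_zero
  rw [Units.smul_def] at ha
  have key : ∀ h : (Projectivization.mk k (v : Fin (r + 1) → k) hv).rep ∈ W,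
      MvPolynomial.eval (φ ⟨_, h⟩) F = (a : k) ^ d * MvPolynomial.eval (φ v) F := by
    intro h
    have h1 : (⟨_, h⟩ : W) = (a : k) • v := Subtype.ext ha.symm
    rw [h1, map_smul, eval_smul_vec (a : k) (φ v) hF]
  constructor
  · rintro ⟨h, h0⟩
    rw [key h] at h0
    exact (mul_eq_zero.mp h0).resolve_left (pow_ne_zero _ ha0)
  · intro h0
    have h : (Projectivization.mk k (v : Fin (r + 1) → k) hv).rep ∈ W :=
      ha ▸ W.smul_mem (a : k) v.2
    exact ⟨h, by rw [key h, h0, mul_zero]⟩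

/-- The points of `S` lie on a plane conic (possibly reducible): the zero locus of a nonzero
ternary quadratic form in some plane. -/
def OnPlaneConic {k : Type*} [Field k] {r : ℕ} (S : Set (PSpace k r)) : Prop :=
  ∃ (W : Submodule k (Fin (r + 1) → k)) (φ : W ≃ₗ[k] (Fin 3 → k)) (Q : MvPolynomial (Fin 3) k),
    Q.IsHomogeneous 2 ∧ Q ≠ 0 ∧ S ⊆ planeCurve φ Q

/-- The plane curves of equations `F = 0` and `G = 0` have no common irreducible component. -/
def NoCommonComponent {k : Type*} [Field k] (F G : MvPolynomial (Fin 3) k) : Prop :=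
  ∀ H : MvPolynomial (Fin 3) k, Irreducible H → H ∣ F → ¬ H ∣ G

end LinkedPoints

end

open LinkedPoints

/-!
Write the points as pairwise non-proportional vectors. A linear relation between the evaluations
in degree `m` can be restricted to the points with nonzero coefficient; such a set is called fully
linked in degree `m`. Multiplying the relation by a form of degree `d` shows that the points off a
hypersurface of degree `d` are fully linked in degree `m - d` (`FullyLinked.residual`). Removing
hyperplanes in this way, a nonempty fully linked set has at least `m + 2` points
(`FullyLinked.card_ge`), it is collinear if it has at most `2m + 1` points
(`FullyLinked.collinear`), and with at most `3m` points, no `m + 2` of them on a line, it is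
coplanar (`FullyLinked.coplanar`).

In the plane two further tools are used. The first one is that the bilinear form given by the
relation is nondegenerate and makes evaluations in complementary degrees orthogonal, so that
`H(i) + H(m - i) ≤ |X|` for the Hilbert function `H` of a fully linked set `X`
(`FullyLinked.hilb_add_le`). The second one is the inequality in Bézout's theorem
(`card_le_mul_of_isRelPrime`), obtained by comparing dimensions of spaces of forms of large degree.

By induction on `m`, a fully linked plane set of at most `3m` points lies on a cubic
(`FullyLinked.onCurve_three`): for `m ≤ 6` this is a count of conditions, and for larger `m` the
points off a cubic through nine of them are handled by the induction hypothesis, unless a line or a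
conic contains many points. With fewer than `3m` points it even lies on a conic
(`FullyLinked.onCurve_two`), and is then collinear if no `2m + 2` of the points are on a conic;
hence all `3m` points occur in the relation. As these points impose at most `3m - 1` conditions on
forms of degree `m`, some such form `G` vanishing on them is not a multiple of the cubic `F`. A
common component of `F` and `G` would be a line or a conic with too many of the points, and Bézout's
bound excludes further common points of the two curves.
-/

namespace LinkedPoints

/-! ### Fully linked sets and residuals -/

section Relations

open MvPolynomial
open scoped Classical

variable {k : Type*} [Field k] {n : ℕ}

/-- A finite set of vectors is *fully linked* in degree `m` if the evaluations at these vectors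
on forms of degree `m` satisfy a linear relation all of whose coefficients are nonzero. -/
def FullyLinked (m : ℕ) (X : Finset (Fin n → k)) : Prop :=
  ∃ c : (Fin n → k) → k, (∀ x ∈ X, c x ≠ 0) ∧
    ∀ g : MvPolynomial (Fin n) k, g.IsHomogeneous m → ∑ x ∈ X, c x * eval x g = 0

/-- The vectors of `X` are nonzero and pairwise non-proportional, so that they represent
distinct points of the projective space. -/
def Distinct (X : Finset (Fin n → k)) : Prop :=
  (∀ x ∈ X, x ≠ 0) ∧ ∀ x ∈ X, ∀ y ∈ X, x ∈ Submodule.span k {y} → x = y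

lemma Distinct.mono {X Y : Finset (Fin n → k)} (hX : Distinct X) (h : Y ⊆ X) : Distinct Y :=
  ⟨fun x hx => hX.1 x (h hx), fun x hx y hy => hX.2 x (h hx) y (h hy)⟩

/-- The linear form with the same values as a linear functional. -/
noncomputable def linearForm (l : Module.Dual k (Fin n → k)) : MvPolynomial (Fin n) k :=
  ∑ i, C (l (Pi.single i 1)) * X i

lemma linearForm_isHomogeneous (l : Module.Dual k (Fin n → k)) :
    (linearForm l).IsHomogeneous 1 :=
  IsHomogeneous.sum _ _ _ fun i _ => isHomogeneous_C_mul_X _ i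

lemma eval_linearForm (l : Module.Dual k (Fin n → k)) (x : Fin n → k) :
    eval x (linearForm l) = l x := by
  conv_rhs => rw [pi_eq_sum_univ' x]
  simp only [linearForm, map_sum, map_mul, eval_C, eval_X, map_smul, smul_eq_mul]
  refine Finset.sum_congr rfl fun i _ => ?_
  rw [mul_comm]

/-- A generic hyperplane through a linear subspace meets a given finite set only in this
subspace. -/
lemma exists_linear_vanishing [Infinite k] (W : Submodule k (Fin n → k))
    (Y : Finset (Fin n → k)) (hY : ∀ y ∈ Y, y ∉ W) :
    ∃ f : MvPolynomial (Fin n) k, f.IsHomogeneous 1 ∧ (∀ w ∈ W, eval w f = 0) ∧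
      ∀ y ∈ Y, eval y f ≠ 0 := by
  obtain ⟨l, hl⟩ := Module.exists_dual_forall_apply_ne_zero (K := k)
    (fun y : Y => W.mkQ y.1) (fun y => by simpa using hY y.1 y.2)
  refine ⟨linearForm (l ∘ₗ W.mkQ), linearForm_isHomogeneous _, fun w hw => ?_, fun y hy => ?_⟩
  · rw [eval_linearForm, LinearMap.comp_apply, W.mkQ_apply,
      (Submodule.Quotient.mk_eq_zero W).2 hw, map_zero]
  · rw [eval_linearForm]
    exact hl ⟨y, hy⟩

/-- Multiplying a relation in degree `m + d` by a form of degree `d` gives a relation in degree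
`m` between the points off the zero locus of this form. -/
lemma FullyLinked.residual {m d : ℕ} {X : Finset (Fin n → k)} (h : FullyLinked (m + d) X)
    {f : MvPolynomial (Fin n) k} (hf : f.IsHomogeneous d) :
    FullyLinked m (X.filter fun x => eval x f ≠ 0) := by
  obtain ⟨c, hc, hrel⟩ := h
  refine ⟨fun x => c x * eval x f, fun x hx => ?_, fun g hg => ?_⟩
  · rw [Finset.mem_filter] at hx
    exact mul_ne_zero (hc x hx.1) hx.2
  · refine Eq.trans ?_ (hrel (g * f) (hg.mul hf))
    rw [Finset.sum_filter]
    refine Finset.sum_congr rfl fun x _ => ?_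
    by_cases h0 : eval x f = 0
    · simp [h0]
    · rw [if_pos h0, map_mul]
      ring

/-- The points off a linear subspace are the points off a generic hyperplane through it. -/
lemma FullyLinked.residual_submodule [Infinite k] {m : ℕ} {X : Finset (Fin n → k)}
    (h : FullyLinked (m + 1) X) (W : Submodule k (Fin n → k)) :
    FullyLinked m (X.filter fun x => x ∉ W) := by
  obtain ⟨f, hf, hW, hY⟩ := exists_linear_vanishing W (X.filter fun x => x ∉ W)
    (fun y hy => (Finset.mem_filter.1 hy).2)
  convert h.residual hf using 1
  refine Finset.filter_congr fun x hx => ⟨fun hxW => hY x (by simp [hx, hxW]), fun h0 hxW => ?_⟩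
  exact h0 (hW x hxW)

/-- A nonempty fully linked set in degree `m` has at least `m + 2` points. -/
lemma FullyLinked.card_ge [Infinite k] {m : ℕ} {X : Finset (Fin n → k)} (h : FullyLinked m X)
    (hX : Distinct X) (hne : X.Nonempty) : m + 2 ≤ X.card := by
  induction m generalizing X with
  | zero =>
    by_contra! hlt
    obtain ⟨x, hx⟩ := hne
    have hX1 : X = {x} := by
      refine (Finset.eq_of_subset_of_card_le (by simpa using hx) ?_).symm
      simp
      omega
    obtain ⟨c, hc, hrel⟩ := h
    have := hrel 1 (isHomogeneous_one _ _)
    rw [hX1] at this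
    exact hc x hx (by simpa using this)
  | succ m ih =>
    obtain ⟨x, hx⟩ := hne
    by_cases h1 : ∃ y ∈ X, y ≠ x
    · obtain ⟨y, hy, hyx⟩ := h1
      have hR := h.residual_submodule (Submodule.span k {x})
      have hyR : y ∈ X.filter (fun z => z ∉ Submodule.span k {x}) :=
        Finset.mem_filter.2 ⟨hy, fun hmem => hyx (hX.2 y hy x hx hmem)⟩
      have h2 := ih hR (hX.mono (Finset.filter_subset _ _)) ⟨y, hyR⟩
      have h3 : X.filter (fun z => z ∉ Submodule.span k {x}) ⊂ X :=
        Finset.filter_ssubset.2 ⟨x, hx, by simp⟩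
      have := Finset.card_lt_card h3
      omega
    · push Not at h1
      have hR := h.residual_submodule ⊥
      have hXR : X.filter (fun z => z ∉ (⊥ : Submodule k (Fin n → k))) = X :=
        Finset.filter_true_of_mem fun z hz => by simpa using hX.1 z hz
      rw [hXR] at hR
      have h2 := ih hR hX ⟨x, hx⟩
      have : X ⊆ {x} := fun y hy => by simpa using h1 y hy
      have := Finset.card_le_card this
      simp at this
      omega

lemma card_mem_add_card_notMem (X : Finset (Fin n → k)) (W : Submodule k (Fin n → k)) :
    (X.filter fun x => x ∈ W).card + (X.filter fun x => x ∉ W).card = X.card :=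
  Finset.card_filter_add_card_filter_not _

/-- If some of the points are off a linear subspace, at least `m + 2` of them are. -/
lemma FullyLinked.card_filter_ge [Infinite k] {m : ℕ} {X : Finset (Fin n → k)}
    (h : FullyLinked (m + 1) X) (hX : Distinct X) {W : Submodule k (Fin n → k)}
    (hW : ¬ ∀ x ∈ X, x ∈ W) : m + 2 ≤ (X.filter fun x => x ∉ W).card := by
  push Not at hW
  obtain ⟨x, hx, hxW⟩ := hW
  exact (h.residual_submodule W).card_ge (hX.mono (Finset.filter_subset _ _))
    ⟨x, Finset.mem_filter.2 ⟨hx, hxW⟩⟩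

lemma finrank_span_pair_le (x y : Fin n → k) : Module.finrank k (Submodule.span k {x, y}) ≤ 2 := by
  have h := finrank_span_finset_le_card (R := k) ({x, y} : Finset (Fin n → k))
  rw [Finset.coe_pair] at h
  exact h.trans Finset.card_le_two

/-- A fully linked set in degree `m` with at most `2m + 1` points is collinear. -/
lemma FullyLinked.collinear [Infinite k] {m : ℕ} {X : Finset (Fin n → k)} (h : FullyLinked m X)
    (hX : Distinct X) (hcard : X.card ≤ 2 * m + 1) :
    ∃ W : Submodule k (Fin n → k), Module.finrank k W ≤ 2 ∧ ∀ x ∈ X, x ∈ W := by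
  induction m generalizing X with
  | zero =>
    rcases X.eq_empty_or_nonempty with rfl | hne
    · exact ⟨⊥, by simp, by simp⟩
    · have := h.card_ge hX hne
      omega
  | succ m ih =>
    rcases X.eq_empty_or_nonempty with rfl | hne
    · exact ⟨⊥, by simp, by simp⟩
    have h3 := h.card_ge hX hne
    obtain ⟨x, hx, y, hy, hxy⟩ := Finset.one_lt_card.1 (by omega : 1 < X.card)
    by_contra! hcon
    obtain ⟨z, hz, hzW⟩ := hcon (Submodule.span k {x, y}) (finrank_span_pair_le x y)
    have hR := h.residual_submodule (Submodule.span k {x, y})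
    set R := X.filter (fun z => z ∉ Submodule.span k {x, y}) with hRdef
    have hsub : {x, y} ⊆ X.filter (fun z => z ∈ Submodule.span k {x, y}) := by
      intro w hw
      have hw' : w ∈ ({x, y} : Set (Fin n → k)) := by simpa using hw
      refine Finset.mem_filter.2 ⟨?_, Submodule.subset_span hw'⟩
      rcases hw' with rfl | rfl <;> assumption
    have h4 := Finset.card_le_card hsub
    rw [Finset.card_pair hxy] at h4
    have h5 : _ + R.card = X.card := card_mem_add_card_notMem X (Submodule.span k {x, y})
    have hRX : Distinct R := hX.mono (Finset.filter_subset _ _)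
    obtain ⟨W, hW, hRW⟩ := ih hR hRX (by omega)
    have h6 := hR.card_ge hRX ⟨z, Finset.mem_filter.2 ⟨hz, hzW⟩⟩
    obtain ⟨w, hw, hwW⟩ := hcon W hW
    have h7 := h.card_filter_ge hX (W := W) (fun hall => hwW (hall w hw))
    have h8 := card_mem_add_card_notMem X W
    have h9 : R ⊆ X.filter (fun z => z ∈ W) := fun u hu =>
      Finset.mem_filter.2 ⟨(Finset.mem_filter.1 hu).1, hRW u hu⟩
    have h10 := Finset.card_le_card h9
    omega

end Relations

/-! ### Coplanarity -/

section Planes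

open MvPolynomial
open scoped Classical

variable {k : Type*} [Field k] {n : ℕ}

lemma finrank_sup_span_singleton_le (L : Submodule k (Fin n → k)) (q : Fin n → k) :
    Module.finrank k ↥(L ⊔ Submodule.span k {q}) ≤ Module.finrank k L + 1 :=
  (Submodule.finrank_add_le_finrank_add_finrank _ _).trans
    (Nat.add_le_add_left (by simpa using finrank_span_le_card (R := k) {q}) _)

/-- If `m + 1` of at most `3m` fully linked points lie on a line, the points off this line are
few enough to be collinear themselves. -/
lemma FullyLinked.subset_two_lines [Infinite k] {j : ℕ} {X : Finset (Fin n → k)}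
    (h : FullyLinked (j + 1) X) (hX : Distinct X) (hcard : X.card ≤ 3 * (j + 1))
    (L : Submodule k (Fin n → k)) (hL : j + 2 ≤ (X.filter fun x => x ∈ L).card) :
    ∃ L' : Submodule k (Fin n → k), Module.finrank k L' ≤ 2 ∧ ∀ x ∈ X, x ∈ L ∨ x ∈ L' := by
  have h1 := card_mem_add_card_notMem X L
  obtain ⟨L', hL', hsub⟩ := (h.residual_submodule L).collinear
    (hX.mono (Finset.filter_subset _ _)) (by omega)
  refine ⟨L', hL', fun x hx => ?_⟩
  by_cases hxL : x ∈ L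
  · exact Or.inl hxL
  · exact Or.inr (hsub x (Finset.mem_filter.2 ⟨hx, hxL⟩))

/-- The points of `X` lie in a plane, or in the union of two lines. -/
def InPlaneOrTwoLines (X : Finset (Fin n → k)) : Prop :=
  (∃ W : Submodule k (Fin n → k), Module.finrank k W ≤ 3 ∧ ∀ x ∈ X, x ∈ W) ∨
    ∃ L L' : Submodule k (Fin n → k), Module.finrank k L ≤ 2 ∧ Module.finrank k L' ≤ 2 ∧
      ∀ x ∈ X, x ∈ L ∨ x ∈ L'

/-- If `m` of at most `3m` fully linked points lie on a line `L`, then either the points are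
coplanar, or a plane through `L` and a further point leaves few enough points to be collinear. -/
lemma FullyLinked.inPlaneOrTwoLines_of_line [Infinite k] {j : ℕ} {X : Finset (Fin n → k)}
    (h : FullyLinked (j + 1) X) (hX : Distinct X) (hcard : X.card ≤ 3 * (j + 1))
    (L : Submodule k (Fin n → k)) (hL2 : Module.finrank k L ≤ 2)
    (hL : j + 1 ≤ (X.filter fun x => x ∈ L).card) : InPlaneOrTwoLines X := by
  by_cases hXL : ∀ x ∈ X, x ∈ L
  · exact Or.inl ⟨L, by omega, hXL⟩
  push Not at hXL
  obtain ⟨q, hq, hqL⟩ := hXL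
  have hM3 := finrank_sup_span_singleton_le L q
  set M := L ⊔ Submodule.span k {q} with hM
  have hqM : q ∈ M := Submodule.mem_sup_right (Submodule.mem_span_singleton_self q)
  by_cases hXM : ∀ x ∈ X, x ∈ M
  · exact Or.inl ⟨M, by omega, hXM⟩
  have h1 : (X.filter fun x => x ∈ L) ⊂ X.filter fun x => x ∈ M := by
    refine Finset.ssubset_iff_subset_ne.2 ⟨fun x hx => ?_, fun heq => ?_⟩
    · rw [Finset.mem_filter] at hx ⊢
      exact ⟨hx.1, Submodule.mem_sup_left hx.2⟩
    · have : q ∈ X.filter fun x => x ∈ L := heq ▸ Finset.mem_filter.2 ⟨hq, hqM⟩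
      exact hqL (Finset.mem_filter.1 this).2
  have h2 := Finset.card_lt_card h1
  have h3 := card_mem_add_card_notMem X M
  have h4 := h.card_filter_ge hX hXM
  obtain ⟨L₁, hL₁, hsub⟩ := (h.residual_submodule M).collinear
    (hX.mono (Finset.filter_subset _ _)) (by omega)
  have h5 : (X.filter fun x => x ∉ M) ⊆ X.filter fun x => x ∈ L₁ := fun x hx =>
    Finset.mem_filter.2 ⟨(Finset.mem_filter.1 hx).1, hsub x hx⟩
  obtain ⟨L', hL', hsub'⟩ := h.subset_two_lines hX hcard L₁ (h4.trans (Finset.card_le_card h5))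
  exact Or.inr ⟨L₁, L', hL₁, hL', hsub'⟩

/-- At most `3m` fully linked points in degree `m` lie in a plane or in two lines. -/
lemma FullyLinked.inPlaneOrTwoLines [Infinite k] {m : ℕ} {X : Finset (Fin n → k)}
    (h : FullyLinked m X) (hX : Distinct X) (hcard : X.card ≤ 3 * m) : InPlaneOrTwoLines X := by
  induction m generalizing X with
  | zero =>
    have hX0 : X = ∅ := Finset.card_eq_zero.1 (by omega)
    exact Or.inl ⟨⊥, by simp, by simp [hX0]⟩
  | succ m ih =>
    rcases le_or_gt X.card 3 with h3 | h3
    · exact Or.inl ⟨Submodule.span k (X : Set (Fin n → k)),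
        (finrank_span_finset_le_card X).trans h3, fun x hx => Submodule.subset_span hx⟩
    have hm : 1 ≤ m := by omega
    obtain ⟨Y, hYX, hY⟩ := Finset.exists_subset_card_eq h3.le
    have hW3 : Module.finrank k (Submodule.span k (Y : Set (Fin n → k))) ≤ Y.card :=
      finrank_span_finset_le_card Y
    set W := Submodule.span k (Y : Set (Fin n → k)) with hW
    by_cases hXW : ∀ x ∈ X, x ∈ W
    · exact Or.inl ⟨W, by omega, hXW⟩
    have h1 : Y ⊆ X.filter fun x => x ∈ W := fun y hy =>
      Finset.mem_filter.2 ⟨hYX hy, Submodule.subset_span hy⟩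
    have h2 := Finset.card_le_card h1
    have h4 := card_mem_add_card_notMem X W
    have hR := h.residual_submodule W
    have hRge := h.card_filter_ge hX hXW
    have hRX : Distinct (X.filter fun x => x ∉ W) := hX.mono (Finset.filter_subset _ _)
    -- It suffices to find a line through at least `m + 1` of the points.
    have key : ∀ Z ⊆ X, m + 1 ≤ Z.card → ∀ L : Submodule k (Fin n → k),
        Module.finrank k L ≤ 2 → (∀ z ∈ Z, z ∈ L) → InPlaneOrTwoLines X := by
      intro Z hZX hZ L hL hZL
      refine h.inPlaneOrTwoLines_of_line hX hcard L hL (hZ.trans (Finset.card_le_card ?_))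
      exact fun z hz => Finset.mem_filter.2 ⟨hZX hz, hZL z hz⟩
    rcases ih hR hRX (by omega) with ⟨W', hW', hsub⟩ | ⟨L, L', hL, hL', hsub⟩
    · by_cases hXW' : ∀ x ∈ X, x ∈ W'
      · exact Or.inl ⟨W', hW', hXW'⟩
      have hRge' := h.card_filter_ge hX hXW'
      have h5 : (X.filter fun x => x ∉ W) ⊆ X.filter fun x => x ∈ W' := fun x hx =>
        Finset.mem_filter.2 ⟨(Finset.mem_filter.1 hx).1, hsub x hx⟩
      have h6 := Finset.card_le_card h5
      have h7 := card_mem_add_card_notMem X W'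
      -- The points off `W` and the points off `W'` are disjoint, so one of these sets is small.
      rcases le_or_gt (X.filter fun x => x ∉ W).card (2 * m + 1) with h8 | h8
      · obtain ⟨L, hL, hRL⟩ := hR.collinear hRX h8
        exact key _ (Finset.filter_subset _ _) (by omega) L hL hRL
      · obtain ⟨L, hL, hRL⟩ := (h.residual_submodule W').collinear
          (hX.mono (Finset.filter_subset _ _)) (by omega)
        exact key _ (Finset.filter_subset _ _) (by omega) L hL hRL
    · by_cases hRL : ∀ x ∈ X.filter (fun x => x ∉ W), x ∈ L
      · exact key _ (Finset.filter_subset _ _) (by omega) L hL hRL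
      · obtain ⟨j, rfl⟩ : ∃ j, m = j + 1 := ⟨m - 1, by omega⟩
        have h5 := hR.card_filter_ge hRX hRL
        refine key _ ((Finset.filter_subset _ _).trans (Finset.filter_subset _ _)) h5 L' hL'
          fun z hz => ?_
        rw [Finset.mem_filter] at hz
        exact (hsub z hz.1).resolve_left hz.2

/-- Fully linked points in degree `m`, at most `3m` in number and no `m + 2` of them on a line,
are coplanar. -/
lemma FullyLinked.coplanar [Infinite k] {m : ℕ} (hm : 1 ≤ m) {X : Finset (Fin n → k)}
    (h : FullyLinked m X) (hX : Distinct X) (hcard : X.card ≤ 3 * m)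
    (hline : ∀ L : Submodule k (Fin n → k), Module.finrank k L ≤ 2 →
      (X.filter fun x => x ∈ L).card ≤ m + 1) :
    ∃ W : Submodule k (Fin n → k), Module.finrank k W ≤ 3 ∧ ∀ x ∈ X, x ∈ W := by
  obtain ⟨j, rfl⟩ : ∃ j, m = j + 1 := ⟨m - 1, by omega⟩
  rcases h.inPlaneOrTwoLines hX hcard with hW | ⟨L, L', hL, hL', hsub⟩
  · exact hW
  by_cases hXL : ∀ x ∈ X, x ∈ L
  · exact ⟨L, by omega, hXL⟩
  push Not at hXL
  obtain ⟨q, hq, hqL⟩ := hXL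
  have hM3 := finrank_sup_span_singleton_le L q
  set M := L ⊔ Submodule.span k {q} with hM
  have hqM : q ∈ M := Submodule.mem_sup_right (Submodule.mem_span_singleton_self q)
  refine ⟨M, by omega, ?_⟩
  by_contra hXM
  -- The points off `M` are points of `L'` other than `q`, and there are too few of them.
  have h1 := h.card_filter_ge hX hXM
  have h2 : (X.filter fun x => x ∉ M) ⊂ X.filter fun x => x ∈ L' := by
    refine Finset.ssubset_iff_subset_ne.2 ⟨fun x hx => ?_, fun heq => ?_⟩
    · rw [Finset.mem_filter] at hx ⊢
      exact ⟨hx.1, (hsub x hx.1).resolve_left fun hxL => hx.2 (Submodule.mem_sup_left hxL)⟩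
    · have : q ∈ X.filter fun x => x ∉ M :=
        heq ▸ Finset.mem_filter.2 ⟨hq, (hsub q hq).resolve_left hqL⟩
      exact (Finset.mem_filter.1 this).2 hqM
  have h3 := Finset.card_lt_card h2
  have h4 := hline L' hL'
  omega

end Planes

/-! ### Factors of forms -/

section HomogeneousFactors

open MvPolynomial

variable {k : Type*} [Field k] {σ : Type*}

/-- The substitution `Xᵢ ↦ T Xᵢ`; its coefficients in `T` are the homogeneous components. -/
noncomputable def dilate : MvPolynomial σ k →ₐ[k] Polynomial (MvPolynomial σ k) :=
  aeval fun i => Polynomial.X * Polynomial.C (X i)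

lemma dilate_monomial (d : σ →₀ ℕ) (a : k) :
    dilate (monomial d a) = Polynomial.monomial d.degree (monomial d a) := by
  rw [dilate, aeval_monomial, Finsupp.prod]
  simp only [mul_pow, Finset.prod_mul_distrib, Finset.prod_pow_eq_pow_sum]
  rw [← Polynomial.C_mul_X_pow_eq_monomial, monomial_eq (s := d), Finsupp.prod, map_mul, map_prod,
    Finsupp.degree]
  simp only [map_pow]
  rw [IsScalarTower.algebraMap_apply k (MvPolynomial σ k) (Polynomial (MvPolynomial σ k))]
  simp only [MvPolynomial.algebraMap_eq, Polynomial.algebraMap_eq, mul_comm, mul_left_comm]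
  rfl

lemma coeff_dilate (p : MvPolynomial σ k) (e : ℕ) :
    (dilate p).coeff e = homogeneousComponent e p := by
  induction p using MvPolynomial.induction_on' with
  | monomial d a =>
    rw [dilate_monomial, Polynomial.coeff_monomial,
      homogeneousComponent_of_mem (isHomogeneous_monomial a rfl)]
    simp only [eq_comm]
  | add p q hp hq => simp [hp, hq]

lemma dilate_of_isHomogeneous {p : MvPolynomial σ k} {d : ℕ} (hp : p.IsHomogeneous d) :
    dilate p = Polynomial.monomial d p := by
  ext1 e
  rw [coeff_dilate, Polynomial.coeff_monomial, homogeneousComponent_of_mem hp]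
  simp only [eq_comm]

/-- The factors of a nonzero form are forms. -/
lemma exists_isHomogeneous_of_mul {p q : MvPolynomial σ k} {d : ℕ}
    (h : (p * q).IsHomogeneous d) (h0 : p * q ≠ 0) :
    ∃ a b, p.IsHomogeneous a ∧ q.IsHomogeneous b ∧ a + b = d := by
  have hmul : dilate p * dilate q = Polynomial.monomial d (p * q) := by
    rw [← map_mul, dilate_of_isHomogeneous h]
  have hne : dilate p * dilate q ≠ 0 := by
    rw [hmul]
    simpa using h0
  have hp0 := left_ne_zero_of_mul hne
  have hq0 := right_ne_zero_of_mul hne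
  have h1 := Polynomial.natDegree_mul hp0 hq0
  have h2 := Polynomial.natTrailingDegree_mul hp0 hq0
  rw [hmul, Polynomial.natDegree_monomial_eq d h0] at h1
  rw [hmul, Polynomial.natTrailingDegree_monomial h0] at h2
  have h3 := (dilate p).natTrailingDegree_le_natDegree
  have h4 := (dilate q).natTrailingDegree_le_natDegree
  have key : ∀ r : MvPolynomial σ k, (dilate r).natTrailingDegree = (dilate r).natDegree →
      r.IsHomogeneous (dilate r).natDegree := by
    intro r hr c hc
    rw [Pi.one_def, ← Finsupp.degree_eq_weight_one]
    have h5 : (dilate r).coeff c.degree ≠ 0 := by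
      rw [coeff_dilate]
      intro h6
      apply hc
      have := coeff_homogeneousComponent c.degree r c
      rw [h6, if_pos rfl] at this
      simpa using this.symm
    exact le_antisymm (Polynomial.le_natDegree_of_ne_zero h5)
      (hr ▸ Polynomial.natTrailingDegree_le_of_ne_zero h5)
  exact ⟨_, _, key p (by omega), key q (by omega), by omega⟩

end HomogeneousFactors

/-! ### Hilbert functions -/

section Ranks

open MvPolynomial
open scoped Classical

variable {k : Type*} [Field k] {n : ℕ}

instance finite_homogeneousSubmodule (j : ℕ) :
    Module.Finite k (homogeneousSubmodule (Fin n) k j) :=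
  Module.Finite.iff_fg.2 (homogeneousSubmodule_fg (Fin n) k j)

/-- Evaluation of forms of degree `j` at the points of `X`. -/
noncomputable def evalMap (X : Finset (Fin n → k)) (j : ℕ) :
    homogeneousSubmodule (Fin n) k j →ₗ[k] (X → k) where
  toFun f x := eval x.1 f.1
  map_add' f g := by ext; simp
  map_smul' a f := by ext; simp [smul_eval]

/-- The Hilbert function of `X`: the number of conditions that `X` imposes on forms of degree
`j`. -/
noncomputable def hilb (X : Finset (Fin n → k)) (j : ℕ) : ℕ :=
  Module.finrank k (LinearMap.range (evalMap X j))

lemma hilb_add_finrank_ker (X : Finset (Fin n → k)) (j : ℕ) :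
    hilb X j + Module.finrank k (LinearMap.ker (evalMap X j)) =
      Module.finrank k (homogeneousSubmodule (Fin n) k j) :=
  LinearMap.finrank_range_add_finrank_ker _

lemma exists_form_of_hilb_lt {X : Finset (Fin n → k)} {j : ℕ}
    (h : hilb X j < Module.finrank k (homogeneousSubmodule (Fin n) k j)) :
    ∃ f : MvPolynomial (Fin n) k, f.IsHomogeneous j ∧ f ≠ 0 ∧ ∀ x ∈ X, eval x f = 0 := by
  have h1 := hilb_add_finrank_ker X j
  have h2 : LinearMap.ker (evalMap X j) ≠ ⊥ := by
    intro h3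
    rw [h3, finrank_bot] at h1
    omega
  obtain ⟨f, hf, hf0⟩ := Submodule.exists_mem_ne_zero_of_ne_bot h2
  refine ⟨f.1, f.2, fun h => hf0 (Subtype.ext h), fun x hx => ?_⟩
  exact congrFun (LinearMap.mem_ker.1 hf) ⟨x, hx⟩

lemma hilb_le_card (X : Finset (Fin n → k)) (j : ℕ) : hilb X j ≤ X.card := by
  have h := Submodule.finrank_le (LinearMap.range (evalMap X j))
  rwa [Module.finrank_fintype_fun_eq_card, Fintype.card_coe] at h

/-- The Hilbert function is nondecreasing: multiply by a linear form vanishing at no point of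
`X`. -/
lemma hilb_le_succ [Infinite k] {X : Finset (Fin n → k)} (hX : Distinct X) (j : ℕ) :
    hilb X j ≤ hilb X (j + 1) := by
  obtain ⟨f, hf, -, hfX⟩ := exists_linear_vanishing ⊥ X (fun y hy => by simpa using hX.1 y hy)
  let D : (X → k) →ₗ[k] (X → k) :=
    { toFun := fun u x => u x * eval x.1 f
      map_add' := fun u v => by ext; simp [add_mul]
      map_smul' := fun a u => by ext; simp [mul_assoc] }
  have hD : Function.Injective D := by
    rw [← LinearMap.ker_eq_bot, LinearMap.ker_eq_bot']
    intro u hu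
    ext x
    exact (mul_eq_zero.1 (congrFun hu x)).resolve_right (hfX x.1 x.2)
  have hsub : (LinearMap.range (evalMap X j)).map D ≤ LinearMap.range (evalMap X (j + 1)) := by
    rintro _ ⟨_, ⟨g, rfl⟩, rfl⟩
    exact ⟨⟨g.1 * f, g.2.mul hf⟩, by ext; simp [evalMap, D]⟩
  calc hilb X j = Module.finrank k ((LinearMap.range (evalMap X j)).map D) :=
        (Submodule.equivMapOfInjective D hD _).finrank_eq
    _ ≤ hilb X (j + 1) := Submodule.finrank_mono hsub

lemma hilb_mono [Infinite k] {X : Finset (Fin n → k)} (hX : Distinct X) {i j : ℕ} (h : i ≤ j) :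
    hilb X i ≤ hilb X j :=
  monotone_nat_of_le_succ (hilb_le_succ hX) h

/-- For fully linked points, evaluations in complementary degrees are orthogonal for the
nondegenerate diagonal bilinear form given by the relation. -/
lemma FullyLinked.hilb_add_le {i j : ℕ} {X : Finset (Fin n → k)} (h : FullyLinked (i + j) X) :
    hilb X i + hilb X j ≤ X.card := by
  obtain ⟨c, hc, hrel⟩ := h
  let B : (X → k) →ₗ[k] Module.Dual k (X → k) :=
    { toFun := fun u => ∑ x : X, (c x.1 * u x) • LinearMap.proj x
      map_add' := fun u v => by simp [mul_add, add_smul, Finset.sum_add_distrib]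
      map_smul' := fun a u => by
        simp only [Pi.smul_apply, smul_eq_mul, RingHom.id_apply, Finset.smul_sum, smul_smul]
        exact Finset.sum_congr rfl fun x _ => by rw [mul_left_comm] }
  have hBapp : ∀ u v, B u v = ∑ x : X, c x.1 * u x * v x := fun u v => by simp [B]
  have hB : Function.Injective B := by
    rw [← LinearMap.ker_eq_bot, LinearMap.ker_eq_bot']
    intro u hu
    ext x
    have h1 := hBapp u (Pi.single x 1)
    rw [hu] at h1
    simp only [LinearMap.zero_apply, Pi.single_apply, mul_ite, mul_one, mul_zero,
      Finset.sum_ite_eq', Finset.mem_univ, if_true] at h1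
    exact (mul_eq_zero.1 h1.symm).resolve_left (hc x.1 x.2)
  have hsub : (LinearMap.range (evalMap X i)).map B ≤
      (LinearMap.range (evalMap X j)).dualAnnihilator := by
    rintro _ ⟨_, ⟨f, rfl⟩, rfl⟩
    rw [Submodule.mem_dualAnnihilator]
    rintro _ ⟨g, rfl⟩
    rw [hBapp, ← hrel (f.1 * g.1) (f.2.mul g.2), ← Finset.sum_coe_sort X]
    exact Finset.sum_congr rfl fun x _ => by simp [evalMap, mul_assoc]
  have h1 := Submodule.finrank_mono hsub
  rw [← (Submodule.equivMapOfInjective B hB _).finrank_eq] at h1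
  have h2 := Subspace.finrank_add_finrank_dualAnnihilator_eq (LinearMap.range (evalMap X j))
  rw [Module.finrank_fintype_fun_eq_card, Fintype.card_coe] at h2
  unfold hilb
  omega

/-- Points that fail to impose independent conditions contain fully linked points. -/
lemma exists_fullyLinked_of_hilb_lt {X : Finset (Fin n → k)} {j : ℕ} (h : hilb X j < X.card) :
    ∃ Y ⊆ X, Y.Nonempty ∧ FullyLinked j Y := by
  have hne : LinearMap.range (evalMap X j) ≠ ⊤ := by
    intro htop
    unfold hilb at h
    rw [htop, finrank_top, Module.finrank_fintype_fun_eq_card, Fintype.card_coe] at h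
    exact lt_irrefl _ h
  obtain ⟨l, hl0, hl⟩ := Submodule.exists_le_ker_of_lt_top _ hne.lt_top
  let c : (Fin n → k) → k := fun x => if hx : x ∈ X then l (Pi.single ⟨x, hx⟩ 1) else 0
  have hlc : ∀ u : X → k, l u = ∑ x : X, c x.1 * u x := by
    intro u
    conv_lhs => rw [pi_eq_sum_univ' u]
    simp only [map_sum, map_smul, smul_eq_mul]
    refine Finset.sum_congr rfl fun x _ => ?_
    rw [mul_comm]
    congr 1
    simp only [c, x.2, dif_pos]
  have hrel : ∀ g : MvPolynomial (Fin n) k, g.IsHomogeneous j → ∑ x ∈ X, c x * eval x g = 0 := by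
    intro g hg
    rw [← Finset.sum_coe_sort X]
    exact (hlc (evalMap X j ⟨g, hg⟩)).symm.trans (LinearMap.mem_ker.1 (hl ⟨_, rfl⟩))
  refine ⟨X.filter fun x => c x ≠ 0, Finset.filter_subset _ _, ?_, c,
    fun x hx => (Finset.mem_filter.1 hx).2, fun g hg => ?_⟩
  · by_contra hemp
    rw [Finset.not_nonempty_iff_eq_empty, Finset.filter_eq_empty_iff] at hemp
    apply hl0
    ext u
    have hc0 : ∀ x : X, c x.1 = 0 := fun x => not_not.1 (hemp x.2)
    simp [hlc, hc0]
  · refine Eq.trans ?_ (hrel g hg)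
    refine Finset.sum_filter_of_ne fun x _ hx => left_ne_zero_of_mul hx

/-- At most `d + 1` points impose independent conditions on forms of degree `d`. -/
lemma hilb_eq_card [Infinite k] {X : Finset (Fin n → k)} (hX : Distinct X) {d : ℕ}
    (h : X.card ≤ d + 1) : hilb X d = X.card := by
  refine le_antisymm (hilb_le_card X d) ?_
  by_contra! hlt
  obtain ⟨Y, hYX, hne, hY⟩ := exists_fullyLinked_of_hilb_lt hlt
  have h1 := hY.card_ge (hX.mono hYX) hne
  have h2 := Finset.card_le_card hYX
  omega

end Ranks

/-! ### Intersections of plane curves -/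

section Bezout

open MvPolynomial
open scoped Classical

variable {k : Type*} [Field k]

lemma finrank_homogeneousSubmodule_fin_three (d : ℕ) :
    Module.finrank k (homogeneousSubmodule (Fin 3) k d) = (d + 2).choose 2 := by
  have hset : {c : Fin 3 →₀ ℕ | c.degree = d} =
      ↑((Finset.univ : Finset (Fin 3)).finsuppAntidiag d) := by
    ext c
    simp [Finsupp.degree_eq_sum]
  rw [homogeneousSubmodule_eq_finsupp_supported, hset,
    (AddMonoidAlgebra.supportedEquivFinsupp (R := k) (S := k) _).finrank_eq,
    Module.finrank_finsupp_self]
  simp only [Finset.coe_sort_coe, Fintype.card_coe]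
  rw [Finset.card_finsuppAntidiag_nat_eq_choose, Finset.card_univ, Fintype.card_fin,
    show 3 + d - 1 = d + 2 by omega]
  exact (Nat.choose_symm_add).symm ▸ rfl

lemma two_mul_finrank (d : ℕ) :
    2 * Module.finrank k (homogeneousSubmodule (Fin 3) k d) = (d + 1) * (d + 2) := by
  rw [finrank_homogeneousSubmodule_fin_three, Nat.choose_two_right, Nat.mul_div_cancel']
  · rw [show d + 2 - 1 = d + 1 by omega, mul_comm]
  · exact even_iff_two_dvd.1 (Nat.even_mul_pred_self _)

variable {n : ℕ}

/-- The cofactor of a form in a form is a form. -/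
lemma exists_eq_mul_of_dvd {F f : MvPolynomial (Fin n) k} {a j : ℕ} (hF : F.IsHomogeneous a)
    (hF0 : F ≠ 0) (hf : f.IsHomogeneous (a + j)) (h : F ∣ f) :
    ∃ u : MvPolynomial (Fin n) k, u.IsHomogeneous j ∧ f = F * u := by
  by_cases hf0 : f = 0
  · exact ⟨0, isHomogeneous_zero _ _ _, by simp [hf0]⟩
  obtain ⟨u, rfl⟩ := h
  obtain ⟨a', b, ha', hb, hab⟩ := exists_isHomogeneous_of_mul hf hf0
  have := hF.inj_right ha' hF0
  obtain rfl : b = j := by omega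
  exact ⟨u, hb, rfl⟩

/-- Multiplication by a form of degree `a`. -/
noncomputable def mulForm {F : MvPolynomial (Fin n) k} {a : ℕ} (hF : F.IsHomogeneous a) (j : ℕ) :
    homogeneousSubmodule (Fin n) k j →ₗ[k] homogeneousSubmodule (Fin n) k (a + j) where
  toFun u := ⟨F * u.1, hF.mul u.2⟩
  map_add' _ _ := Subtype.ext (mul_add _ _ _)
  map_smul' _ _ := Subtype.ext (mul_smul_comm _ _ _)

/-- If the forms of degree `j` through `X` are all multiples of one cubic form, then `X` imposes
at least `3j` conditions on forms of degree `j`. -/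
lemma three_mul_le_hilb {X : Finset (Fin 3 → k)} {F : MvPolynomial (Fin 3) k}
    (hF : F.IsHomogeneous 3) (hF0 : F ≠ 0) {j : ℕ}
    (h : ∀ f : MvPolynomial (Fin 3) k, f.IsHomogeneous j → (∀ x ∈ X, eval x f = 0) → F ∣ f) :
    3 * j ≤ hilb X j := by
  have hker : ∀ f ∈ LinearMap.ker (evalMap X j), F ∣ f.1 := fun f hf =>
    h f.1 f.2 fun x hx => congrFun (LinearMap.mem_ker.1 hf) ⟨x, hx⟩
  have h1 := hilb_add_finrank_ker X j
  have h2 := two_mul_finrank (k := k) j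
  rcases lt_or_ge j 3 with hj | hj
  · have hbot : LinearMap.ker (evalMap X j) = ⊥ := by
      rw [Submodule.eq_bot_iff]
      intro f hf
      by_contra hf0
      obtain ⟨u, hu⟩ := hker f hf
      have hfu : (F * u).IsHomogeneous j := hu ▸ f.2
      obtain ⟨a, b, ha, -, hab⟩ := exists_isHomogeneous_of_mul hfu
        (hu ▸ fun h => hf0 (Subtype.ext h))
      have := hF.inj_right ha hF0
      omega
    rw [hbot, finrank_bot] at h1
    interval_cases j <;> omega
  · obtain ⟨i, rfl⟩ := Nat.exists_eq_add_of_le hj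
    have hsub : LinearMap.ker (evalMap X (3 + i)) ≤ LinearMap.range (mulForm hF i) := by
      intro f hf
      obtain ⟨u, hu, hfu⟩ := exists_eq_mul_of_dvd hF hF0 f.2 (hker f hf)
      exact ⟨⟨u, hu⟩, Subtype.ext hfu.symm⟩
    have h3 := (Submodule.finrank_mono hsub).trans (LinearMap.finrank_range_le (mulForm hF i))
    have h4 := two_mul_finrank (k := k) i
    nlinarith

/-- The number of common points of two plane curves without common component is at most the
product of the degrees. -/
theorem card_le_mul_of_isRelPrime [Infinite k] {X : Finset (Fin 3 → k)} (hX : Distinct X)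
    {F G : MvPolynomial (Fin 3) k} {a b : ℕ} (hF : F.IsHomogeneous a) (hG : G.IsHomogeneous b)
    (hG0 : G ≠ 0) (hFG : IsRelPrime F G) (hFX : ∀ x ∈ X, eval x F = 0)
    (hGX : ∀ x ∈ X, eval x G = 0) : X.card ≤ a * b := by
  set N := X.card with hN
  -- In degree `a + b + N` the `N` points impose independent conditions.
  have e1 : a + (b + N) = a + b + N := by ring
  have e2 : b + (a + N) = a + b + N := by ring
  let T : (homogeneousSubmodule (Fin 3) k (b + N) × homogeneousSubmodule (Fin 3) k (a + N)) →ₗ[k]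
      homogeneousSubmodule (Fin 3) k (a + b + N) :=
    { toFun := fun u => ⟨F * u.1.1 + G * u.2.1,
        (e1 ▸ hF.mul u.1.2 : (F * u.1.1).IsHomogeneous _).add (e2 ▸ hG.mul u.2.2)⟩
      map_add' := fun u v => Subtype.ext <| by
        simp only [Prod.fst_add, Prod.snd_add, Submodule.coe_add]
        ring
      map_smul' := fun c u => Subtype.ext (by simp [smul_add]) }
  let S : homogeneousSubmodule (Fin 3) k N →ₗ[k]
      (homogeneousSubmodule (Fin 3) k (b + N) × homogeneousSubmodule (Fin 3) k (a + N)) :=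
    (mulForm hG N).prod (-mulForm hF N)
  have hrange : LinearMap.range T ≤ LinearMap.ker (evalMap X (a + b + N)) := by
    rintro _ ⟨u, rfl⟩
    rw [LinearMap.mem_ker]
    ext x
    simp [T, evalMap, hFX x.1 x.2, hGX x.1 x.2]
  -- The syzygies of two coprime forms are the trivial ones.
  have hker : LinearMap.ker T ≤ LinearMap.range S := by
    rintro ⟨u, v⟩ huv
    have h0 : F * u.1 + G * v.1 = 0 := congrArg Subtype.val (LinearMap.mem_ker.1 huv)
    have hdvd : G ∣ F * u.1 := ⟨-v.1, by linear_combination h0⟩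
    obtain ⟨w, hw, huw⟩ := exists_eq_mul_of_dvd hG hG0 u.2 (hFG.symm.dvd_of_dvd_mul_left hdvd)
    have hvw : v.1 = -(F * w) := by
      refine mul_left_cancel₀ hG0 ?_
      rw [huw] at h0
      linear_combination h0
    exact ⟨⟨w, hw⟩, Prod.ext (Subtype.ext huw.symm) (Subtype.ext hvw.symm)⟩
  have h1 := Submodule.finrank_mono hrange
  have h2 := (Submodule.finrank_mono hker).trans (LinearMap.finrank_range_le S)
  have h3 := LinearMap.finrank_range_add_finrank_ker T
  rw [Module.finrank_prod] at h3
  have h4 := hilb_add_finrank_ker X (a + b + N)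
  rw [hilb_eq_card hX (by omega)] at h4
  have h5 := two_mul_finrank (k := k) N
  have h6 := two_mul_finrank (k := k) (a + N)
  have h7 := two_mul_finrank (k := k) (b + N)
  have h8 := two_mul_finrank (k := k) (a + b + N)
  nlinarith

lemma card_filter_le_mul_of_isRelPrime [Infinite k] {X : Finset (Fin 3 → k)} (hX : Distinct X)
    {D F G : MvPolynomial (Fin 3) k} {a b : ℕ} (hF : F.IsHomogeneous a) (hG : G.IsHomogeneous b)
    (hG0 : G ≠ 0) (hFG : IsRelPrime F G) (hFX : ∀ x ∈ X, eval x (D * F) = 0)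
    (hGX : ∀ x ∈ X, eval x (D * G) = 0) : (X.filter fun x => eval x D ≠ 0).card ≤ a * b := by
  refine card_le_mul_of_isRelPrime (hX.mono (Finset.filter_subset _ _)) hF hG hG0 hFG
    (fun x hx => ?_) (fun x hx => ?_) <;> rw [Finset.mem_filter] at hx
  · have := hFX x hx.1
    rw [map_mul] at this
    exact (mul_eq_zero.1 this).resolve_left hx.2
  · have := hGX x hx.1
    rw [map_mul] at this
    exact (mul_eq_zero.1 this).resolve_left hx.2

/-- Points on a cubic `F` and on a curve `G` of degree `i` which does not contain it: either the
curves have no common component and there are at most `3i` points, or all but few points lie on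
their common line or conic. -/
lemma cubic_inter [Infinite k] {X : Finset (Fin 3 → k)} (hX : Distinct X)
    {F G : MvPolynomial (Fin 3) k} {i : ℕ} (hF : F.IsHomogeneous 3) (hF0 : F ≠ 0)
    (hG : G.IsHomogeneous i) (hFG : ¬ F ∣ G)
    (hFX : ∀ x ∈ X, eval x F = 0) (hGX : ∀ x ∈ X, eval x G = 0) :
    (IsRelPrime F G ∧ X.card ≤ 3 * i) ∨
      ∃ (D : MvPolynomial (Fin 3) k) (e : ℕ), (e = 1 ∨ e = 2) ∧ e ≤ i ∧ D.IsHomogeneous e ∧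
        D ≠ 0 ∧ (X.filter fun x => eval x D ≠ 0).card ≤ (3 - e) * (i - e) := by
  have hG0 : G ≠ 0 := fun h => hFG (h ▸ dvd_zero F)
  obtain ⟨F', G', D, hrel, rfl, rfl⟩ := UniqueFactorizationMonoid.exists_reduced_factors F hF0 G
  obtain ⟨e, a, hDe, hF'a, hea⟩ := exists_isHomogeneous_of_mul hF hF0
  obtain ⟨e', b, hDe', hG'b, heb⟩ := exists_isHomogeneous_of_mul hG hG0
  have hD0 := left_ne_zero_of_mul hF0
  obtain rfl := hDe.inj_right hDe' hD0
  have unit_of_zero : ∀ {p : MvPolynomial (Fin 3) k}, p.IsHomogeneous 0 → p ≠ 0 → IsUnit p := by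
    intro p hp hp0
    rw [← totalDegree_zero_iff_isHomogeneous, totalDegree_eq_zero_iff_eq_C] at hp
    rw [hp]
    refine (IsUnit.mk0 _ fun h0 => hp0 ?_).map C
    rw [hp, h0, C_0]
  have hcases : e = 0 ∨ (e = 1 ∨ e = 2) ∨ e = 3 := by omega
  rcases hcases with rfl | he | rfl
  · left
    have hDu := unit_of_zero hDe hD0
    have hrel' : IsRelPrime (D * F') (D * G') :=
      (isRelPrime_mul_unit_left_left hDu).2 ((isRelPrime_mul_unit_left_right hDu).2 hrel)
    exact ⟨hrel', card_le_mul_of_isRelPrime hX hF hG hG0 hrel' hFX hGX⟩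
  · right
    refine ⟨D, e, he, by omega, hDe, hD0, ?_⟩
    rw [show 3 - e = a by omega, show i - e = b by omega]
    exact card_filter_le_mul_of_isRelPrime hX hF'a hG'b (right_ne_zero_of_mul hG0) hrel hFX hGX
  · obtain rfl : a = 0 := by omega
    have hFu := unit_of_zero hF'a (right_ne_zero_of_mul hF0)
    exact absurd (mul_dvd_mul_left D hFu.dvd) hFG

end Bezout

/-! ### Fully linked sets in the plane -/

section PlaneCurves

open MvPolynomial
open scoped Classical

variable {k : Type*} [Field k]

/-- Some nonzero form of degree `d` vanishes at all points of `X`. -/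
def OnCurve {n : ℕ} (d : ℕ) (X : Finset (Fin n → k)) : Prop :=
  ∃ F : MvPolynomial (Fin n) k, F.IsHomogeneous d ∧ F ≠ 0 ∧ ∀ x ∈ X, eval x F = 0

lemma card_eval_eq_zero_add {n : ℕ} (X : Finset (Fin n → k)) (F : MvPolynomial (Fin n) k) :
    (X.filter fun x => eval x F = 0).card + (X.filter fun x => eval x F ≠ 0).card = X.card :=
  Finset.card_filter_add_card_filter_not _

lemma OnCurve.mul {n a b : ℕ} {X : Finset (Fin n → k)} {F : MvPolynomial (Fin n) k}
    (hF : F.IsHomogeneous a) (hF0 : F ≠ 0) (h : OnCurve b (X.filter fun x => eval x F ≠ 0)) :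
    OnCurve (a + b) X := by
  obtain ⟨G, hG, hG0, hGX⟩ := h
  refine ⟨F * G, hF.mul hG, mul_ne_zero hF0 hG0, fun x hx => ?_⟩
  rw [map_mul]
  by_cases h0 : eval x F = 0
  · rw [h0, zero_mul]
  · rw [hGX x (Finset.mem_filter.2 ⟨hx, h0⟩), mul_zero]

lemma OnCurve.mono {n a b : ℕ} [NeZero n] {X : Finset (Fin n → k)} (h : OnCurve a X) (hab : a ≤ b) :
    OnCurve b X := by
  obtain ⟨F, hF, hF0, hFX⟩ := h
  obtain ⟨c, rfl⟩ := Nat.exists_eq_add_of_le hab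
  refine OnCurve.mul hF hF0
    ⟨MvPolynomial.X 0 ^ c, isHomogeneous_X_pow _ _, pow_ne_zero _ (X_ne_zero _), ?_⟩
  intro x hx
  rw [Finset.mem_filter] at hx
  exact absurd (hFX x hx.1) hx.2

lemma hilb_eq_of_not_onCurve {X : Finset (Fin 3 → k)} {d : ℕ} (h : ¬ OnCurve d X) :
    hilb X d = (d + 2).choose 2 := by
  rw [← finrank_homogeneousSubmodule_fin_three (k := k)]
  refine le_antisymm ?_ (not_lt.1 fun hlt => h (exists_form_of_hilb_lt hlt))
  have := hilb_add_finrank_ker X d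
  omega

lemma exists_linear_of_finrank_le [Infinite k] {W : Submodule k (Fin 3 → k)}
    (hW : Module.finrank k W ≤ 2) :
    ∃ f : MvPolynomial (Fin 3) k, f.IsHomogeneous 1 ∧ f ≠ 0 ∧ ∀ w ∈ W, eval w f = 0 := by
  have hne : W ≠ ⊤ := by
    rintro rfl
    rw [finrank_top, Module.finrank_fin_fun] at hW
    omega
  obtain ⟨y, -, hy⟩ := SetLike.exists_of_lt hne.lt_top
  obtain ⟨f, hf, hfW, hfy⟩ := exists_linear_vanishing W {y} (by simpa using hy)
  refine ⟨f, hf, fun h => hfy y (by simp) (by rw [h, map_zero]), hfW⟩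

lemma exists_finrank_le_of_linear [Infinite k] {D : MvPolynomial (Fin 3) k}
    (hD : D.IsHomogeneous 1) (hD0 : D ≠ 0) :
    ∃ W : Submodule k (Fin 3 → k), Module.finrank k W ≤ 2 ∧ ∀ x, eval x D = 0 → x ∈ W := by
  obtain ⟨l, hl⟩ : ∃ l : Module.Dual k (Fin 3 → k), ∀ x, l x = eval x D := by
    have hmem : D ∈ Submodule.span k (Set.range (X : Fin 3 → MvPolynomial (Fin 3) k)) := by
      rw [← homogeneousSubmodule_one_eq_span_X]
      exact hD
    clear hD hD0
    induction hmem using Submodule.span_induction with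
    | mem f hf =>
      obtain ⟨i, rfl⟩ := hf
      exact ⟨LinearMap.proj i, fun x => by simp⟩
    | zero => exact ⟨0, fun x => by simp⟩
    | add f g _ _ hf hg =>
      obtain ⟨l, hl⟩ := hf
      obtain ⟨l', hl'⟩ := hg
      exact ⟨l + l', fun x => by simp [hl, hl']⟩
    | smul a f _ hf =>
      obtain ⟨l, hl⟩ := hf
      exact ⟨a • l, fun x => by simp [hl, smul_eval]⟩
  refine ⟨LinearMap.ker l, ?_, fun x hx => by rw [LinearMap.mem_ker, hl, hx]⟩
  by_contra! hlt
  have h1 := LinearMap.finrank_range_add_finrank_ker l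
  rw [Module.finrank_fin_fun] at h1
  have h2 : LinearMap.range l = ⊥ := Submodule.finrank_eq_zero.1 (by omega)
  refine hD0 (MvPolynomial.funext fun x => ?_)
  rw [← hl, LinearMap.range_eq_bot.1 h2, LinearMap.zero_apply, map_zero]

/-- Fewer than `3m` fully linked points in degree `m` which lie on a cubic lie on a conic.
Otherwise, for the least degree `i` of a curve through the points which does not contain the
cubic, the inequality between Hilbert functions in complementary degrees contradicts the bound
`3i` for the number of points. -/
lemma FullyLinked.onCurve_two [Infinite k] {m : ℕ} {X : Finset (Fin 3 → k)}
    (h : FullyLinked m X) (hX : Distinct X) (hcard : X.card < 3 * m) (hcubic : OnCurve 3 X) :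
    OnCurve 2 X := by
  by_contra hno
  obtain ⟨F, hF, hF0, hFX⟩ := hcubic
  have h2 : hilb X 2 = 6 := hilb_eq_of_not_onCurve hno
  have h1 : hilb X 1 = 3 := hilb_eq_of_not_onCurve fun h1 => hno (h1.mono (by omega))
  obtain ⟨j, rfl⟩ : ∃ j, m = j + 1 := ⟨m - 1, by omega⟩
  let P : ℕ → Prop := fun i => ∃ G : MvPolynomial (Fin 3) k, G.IsHomogeneous i ∧
    (∀ x ∈ X, eval x G = 0) ∧ ¬ F ∣ G
  have hP : ∀ i, ¬ P i → 3 * i ≤ hilb X i := fun i hi =>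
    three_mul_le_hilb hF hF0 fun f hf hfX => not_not.1 fun hdvd => hi ⟨f, hf, hfX, hdvd⟩
  by_cases hj : P j
  swap
  -- Here `H(m - 1) ≥ 3 (m - 1)` and `H(1) = 3`, although `|X| < 3m`.
  · have h3 := hP j hj
    have h4 := h.hilb_add_le
    omega
  have hex : ∃ i, P i := ⟨j, hj⟩
  obtain ⟨i, hi, hmin⟩ : ∃ i, P i ∧ ∀ l < i, ¬ P l :=
    ⟨Nat.find hex, Nat.find_spec hex, fun l hl => Nat.find_min hex hl⟩
  have hij : i ≤ j := not_lt.1 fun hlt => hmin j hlt hj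
  obtain ⟨G, hG, hGX, hFG⟩ := hi
  rcases cubic_inter hX hF hF0 hG hFG hFX hGX with ⟨-, hle⟩ | ⟨D, e, he, hei, hD, hD0, hle⟩
  -- With `l = i - 1`, `H(l) ≥ 3l` and `H(m - l) ≥ H(2) = 6` give `|X| ≥ 3i + 3`.
  · have h5 := hilb_le_card X 2
    obtain ⟨l, rfl⟩ : ∃ l, i = l + 1 := ⟨i - 1, by omega⟩
    obtain ⟨t, rfl⟩ := Nat.exists_eq_add_of_le hij
    have h6 := hP l (hmin l (by omega))
    have h7 : FullyLinked (l + (t + 2)) X := by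
      convert h using 1
      omega
    have h8 := h7.hilb_add_le
    have h9 := hilb_mono hX (show 2 ≤ t + 2 by omega)
    omega
  · have hdist := hX.mono (Finset.filter_subset (fun x => eval x D ≠ 0) X)
    rcases he with rfl | rfl
    · obtain ⟨W, hW, hsub⟩ := (h.residual hD).collinear hdist (by omega)
      obtain ⟨f, hf, hf0, hfW⟩ := exists_linear_of_finrank_le hW
      exact hno (OnCurve.mul hD hD0 ⟨f, hf, hf0, fun x hx => hfW x (hsub x hx)⟩)
    · obtain ⟨l, rfl⟩ : ∃ l, j = l + 1 := ⟨j - 1, by omega⟩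
      have hR : FullyLinked l (X.filter fun x => eval x D ≠ 0) :=
        FullyLinked.residual (d := 2) h hD
      rcases Finset.eq_empty_or_nonempty (X.filter fun x => eval x D ≠ 0) with hemp | hne
      · refine hno ⟨D, hD, hD0, fun x hx => ?_⟩
        by_contra h0
        exact Finset.notMem_empty x (hemp ▸ Finset.mem_filter.2 ⟨hx, h0⟩)
      · have := hR.card_ge hdist hne
        omega

/-- At most `3m` fully linked points in degree `m` of the plane lie on a cubic. -/
theorem FullyLinked.onCurve_three [Infinite k] {m : ℕ} {X : Finset (Fin 3 → k)}
    (h : FullyLinked m X) (hX : Distinct X) (hcard : X.card ≤ 3 * m) : OnCurve 3 X := by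
  induction m using Nat.strong_induction_on generalizing X with
  | _ m ih =>
  by_contra hno
  have hconic : ∀ j < m, ∀ Y ⊆ X, FullyLinked j Y → Y.card < 3 * j → OnCurve 2 Y :=
    fun j hj Y hYX hY hYc =>
      hY.onCurve_two (hX.mono hYX) hYc (ih j hj hY (hX.mono hYX) hYc.le)
  have h3 : hilb X 3 = 10 := hilb_eq_of_not_onCurve hno
  have h10 := hilb_le_card X 3
  have hres : ∀ F : MvPolynomial (Fin 3) k, ∀ d ≤ 3, F.IsHomogeneous d → F ≠ 0 →
      (X.filter fun x => eval x F ≠ 0).Nonempty := by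
    intro F d hd hF hF0
    by_contra hemp
    rw [Finset.not_nonempty_iff_eq_empty, Finset.filter_eq_empty_iff] at hemp
    exact hno (OnCurve.mono ⟨F, hF, hF0, fun x hx => not_not.1 (hemp hx)⟩ hd)
  -- A line through four of the points leaves few enough points to lie on a conic.
  have hline : ∀ W : Submodule k (Fin 3 → k), Module.finrank k W ≤ 2 → ∀ Z ⊆ X,
      (∀ z ∈ Z, z ∈ W) → Z.card ≤ 3 := by
    intro W hW Z hZX hZW
    by_contra! hlt
    obtain ⟨f, hf, hf0, hfW⟩ := exists_linear_of_finrank_le hW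
    obtain ⟨j, rfl⟩ : ∃ j, m = j + 1 := ⟨m - 1, by omega⟩
    have hsub : Z ⊆ X.filter fun x => eval x f = 0 := fun z hz =>
      Finset.mem_filter.2 ⟨hZX hz, hfW z (hZW z hz)⟩
    have h4 := Finset.card_le_card hsub
    have h5 := card_eval_eq_zero_add X f
    exact hno (OnCurve.mul hf hf0
      (hconic j (by omega) _ (Finset.filter_subset _ _) (h.residual hf) (by omega)))
  -- Fewer fully linked points would be collinear, which is excluded by `hline`.
  have hfew : ∀ j, 2 ≤ j → ∀ Z ⊆ X, Z.Nonempty → FullyLinked j Z → 2 * j + 2 ≤ Z.card := by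
    intro j hj Z hZX hne hZ
    by_contra! hlt
    obtain ⟨W, hW, hZW⟩ := hZ.collinear (hX.mono hZX) (by omega)
    have h4 := hline W hW Z hZX hZW
    have h5 := hZ.card_ge (hX.mono hZX) hne
    omega
  rcases le_or_gt m 6 with hm6 | hm7
  · -- Here the forms of degree `m - 3 ≤ 3` through the points are not all zero.
    obtain ⟨j, rfl⟩ : ∃ j, m = j + 3 := ⟨m - 3, by omega⟩
    have h4 := h.hilb_add_le
    have h5 := hilb_eq_of_not_onCurve fun h5 : OnCurve j X => hno (h5.mono (by omega))
    have hj : 1 ≤ j := by omega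
    have hj3 : j ≤ 3 := by omega
    interval_cases j <;> simp [Nat.choose] at h5 <;> omega
  obtain ⟨j, rfl⟩ : ∃ j, m = j + 3 := ⟨m - 3, by omega⟩
  -- A conic through seven of the points would leave two disjoint residual sets, both large.
  have hconic6 : ∀ C : MvPolynomial (Fin 3) k, C.IsHomogeneous 2 → C ≠ 0 →
      (X.filter fun x => eval x C = 0).card ≤ 6 := by
    intro C hC hC0
    by_contra! hlt
    have h4 := card_eval_eq_zero_add X C
    have hR : FullyLinked (j + 1) (X.filter fun x => eval x C ≠ 0) :=
      FullyLinked.residual (d := 2) h hC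
    obtain ⟨C', hC', hC'0, hRC'⟩ :=
      hconic (j + 1) (by omega) _ (Finset.filter_subset _ _) hR (by omega)
    have hR' : FullyLinked (j + 1) (X.filter fun x => eval x C' ≠ 0) :=
      FullyLinked.residual (d := 2) h hC'
    have h5 := card_eval_eq_zero_add X C'
    have hsub : (X.filter fun x => eval x C ≠ 0) ⊆ X.filter fun x => eval x C' = 0 := fun x hx =>
      Finset.mem_filter.2 ⟨(Finset.mem_filter.1 hx).1, hRC' x hx⟩
    have h6 := Finset.card_le_card hsub
    have h7 := hfew (j + 1) (by omega) _ (Finset.filter_subset _ _)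
      (hres C 2 (by omega) hC hC0) hR
    have h8 := hfew (j + 1) (by omega) _ (Finset.filter_subset _ _)
      (hres C' 2 (by omega) hC' hC'0) hR'
    omega
  -- Apply the induction hypothesis to the points off a cubic through nine of the points.
  obtain ⟨Y, hYX, hY⟩ := Finset.exists_subset_card_eq (show 9 ≤ X.card by omega)
  obtain ⟨F, hF, hF0, hFY⟩ : OnCurve 3 Y := by
    by_contra hcon
    have h4 : hilb Y 3 = 10 := hilb_eq_of_not_onCurve hcon
    have h5 := hilb_le_card Y 3
    omega
  have hsubF : Y ⊆ X.filter fun x => eval x F = 0 := fun y hy =>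
    Finset.mem_filter.2 ⟨hYX hy, hFY y hy⟩
  have h4 := Finset.card_le_card hsubF
  have h5 := card_eval_eq_zero_add X F
  have hR := h.residual hF
  have hRne := hres F 3 le_rfl hF hF0
  have hRX := Finset.filter_subset (fun x => eval x F ≠ 0) X
  set R := X.filter fun x => eval x F ≠ 0 with hRdef
  have h6 := hfew j (by omega) R hRX hRne hR
  rcases lt_or_ge R.card (3 * j) with hlt | hge
  · obtain ⟨C, hC, hC0, hRC⟩ := hconic j (by omega) R hRX hR hlt
    have hsub : R ⊆ X.filter fun x => eval x C = 0 := fun x hx =>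
      Finset.mem_filter.2 ⟨hRX hx, hRC x hx⟩
    have h7 := Finset.card_le_card hsub
    have h8 := hconic6 C hC hC0
    omega
  · obtain ⟨F', hF', hF'0, hRF'⟩ := ih j (by omega) hR (hX.mono hRX) (by omega)
    have hsub : R ⊆ X.filter fun x => eval x F' = 0 := fun x hx =>
      Finset.mem_filter.2 ⟨hRX hx, hRF' x hx⟩
    have h7 := Finset.card_le_card hsub
    have h8 := card_eval_eq_zero_add X F'
    have h9 := hfew j (by omega) _ (Finset.filter_subset _ _)
      (hres F' 3 le_rfl hF' hF'0) (h.residual hF')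
    omega

/-- If at most `3m` points are fully linked in degree `m`, no `m + 2` of them on a line and no
`2m + 2` on a conic, then there are exactly `3m` points, and they lie on a cubic and on a curve of
degree `m` without common component. -/
theorem FullyLinked.exists_complete_intersection [Infinite k] {m : ℕ} (hm : 1 ≤ m)
    {X : Finset (Fin 3 → k)} (h : FullyLinked m X) (hX : Distinct X) (hcard : X.card ≤ 3 * m)
    (hline : ∀ W : Submodule k (Fin 3 → k), Module.finrank k W ≤ 2 →
      (X.filter fun x => x ∈ W).card ≤ m + 1)
    (hconic : ∀ Q : MvPolynomial (Fin 3) k, Q.IsHomogeneous 2 → Q ≠ 0 →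
      (X.filter fun x => eval x Q = 0).card ≤ 2 * m + 1) (hne : X.Nonempty) :
    X.card = 3 * m ∧ ∃ F G : MvPolynomial (Fin 3) k, F.IsHomogeneous 3 ∧ F ≠ 0 ∧
      G.IsHomogeneous m ∧ G ≠ 0 ∧ IsRelPrime F G ∧
      ∀ x ∈ X, eval x F = 0 ∧ eval x G = 0 := by
  have hcubic := h.onCurve_three hX hcard
  have hcard' : X.card = 3 * m := by
    by_contra hcon
    obtain ⟨Q, hQ, hQ0, hQX⟩ := h.onCurve_two hX (by omega) hcubic
    have h1 := hconic Q hQ hQ0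
    rw [Finset.filter_true_of_mem hQX] at h1
    obtain ⟨W, hW, hXW⟩ := h.collinear hX h1
    have h2 := hline W hW
    rw [Finset.filter_true_of_mem hXW] at h2
    have h3 := h.card_ge hX hne
    omega
  refine ⟨hcard', ?_⟩
  obtain ⟨F, hF, hF0, hFX⟩ := hcubic
  obtain ⟨G, hG, hGX, hFG⟩ : ∃ G : MvPolynomial (Fin 3) k, G.IsHomogeneous m ∧
      (∀ x ∈ X, eval x G = 0) ∧ ¬ F ∣ G := by
    by_contra! hcon
    have h1 := three_mul_le_hilb hF hF0 hcon
    have h2 : hilb X m + hilb X 0 ≤ X.card := FullyLinked.hilb_add_le h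
    have h3 : hilb X 0 = 1 := hilb_eq_of_not_onCurve fun ⟨f, hf, hf0, hfX⟩ => by
      obtain ⟨x, hx⟩ := hne
      rw [← totalDegree_zero_iff_isHomogeneous, totalDegree_eq_zero_iff_eq_C] at hf
      have h4 := hfX x hx
      rw [hf, eval_C] at h4
      exact hf0 (by rw [hf, h4, C_0])
    omega
  refine ⟨F, G, hF, hF0, hG, fun h0 => hFG (h0 ▸ dvd_zero F), ?_, fun x hx => ⟨hFX x hx, hGX x hx⟩⟩
  rcases cubic_inter hX hF hF0 hG hFG hFX hGX with ⟨hrel, -⟩ | ⟨D, e, he, hei, hD, hD0, hle⟩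
  · exact hrel
  have h1 := card_eval_eq_zero_add X D
  rcases he with rfl | rfl
  -- There would be at most `(m + 1) + 2 (m - 1)`, respectively `(2m + 1) + (m - 2)`, points.
  · obtain ⟨W, hW, hDW⟩ := exists_finrank_le_of_linear hD hD0
    have h2 := hline W hW
    have h3 : (X.filter fun x => eval x D = 0) ⊆ X.filter fun x => x ∈ W := fun x hx => by
      rw [Finset.mem_filter] at hx ⊢
      exact ⟨hx.1, hDW x hx.2⟩
    have h4 := Finset.card_le_card h3
    omega
  · have h2 := hconic D hD hD0
    omega

end PlaneCurves

/-! ### From projective points to coordinate vectors -/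

section Transport

open MvPolynomial
open scoped Classical

variable {k : Type*} [Field k] {n p : ℕ}

/-- Pulling back forms along a linear map pushes relations forward along this map. -/
lemma FullyLinked.image {m : ℕ} {X : Finset (Fin n → k)} (h : FullyLinked m X)
    (A : (Fin n → k) →ₗ[k] (Fin p → k)) (B : (Fin p → k) → (Fin n → k))
    (hBA : ∀ x ∈ X, B (A x) = x) : FullyLinked m (X.image A) := by
  obtain ⟨c, hc, hrel⟩ := h
  have hinj : Set.InjOn A (X : Set (Fin n → k)) := fun x hx y hy hxy => by
    rw [← hBA x hx, hxy, hBA y hy]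
  refine ⟨fun y => c (B y), fun y hy => ?_, fun g hg => ?_⟩
  · obtain ⟨x, hx, rfl⟩ := Finset.mem_image.1 hy
    simpa only [hBA x hx] using hc x hx
  · rw [Finset.sum_image hinj]
    have hhom : (bind₁ (fun i => linearForm (LinearMap.proj i ∘ₗ A)) g).IsHomogeneous m := by
      have := hg.aeval (fun i => linearForm (LinearMap.proj i ∘ₗ A))
        (fun i => linearForm_isHomogeneous _)
      rwa [one_mul] at this
    rw [← hrel _ hhom]
    refine Finset.sum_congr rfl fun x hx => ?_
    have heval : eval x (bind₁ (fun i => linearForm (LinearMap.proj i ∘ₗ A)) g) = eval (A x) g := by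
      refine (eval₂Hom_bind₁ _ _ _ _).trans ?_
      have hi : (fun i => eval x (linearForm (LinearMap.proj i ∘ₗ A))) = A x :=
        funext fun i => eval_linearForm _ x
      exact congrArg (fun y => eval y g) hi
    rw [heval]
    simp only [hBA x hx]

lemma Distinct.image {X : Finset (Fin n → k)} (h : Distinct X)
    (A : (Fin n → k) →ₗ[k] (Fin p → k)) (B : (Fin p → k) →ₗ[k] (Fin n → k))
    (hBA : ∀ x ∈ X, B (A x) = x) : Distinct (X.image A) := by
  refine ⟨fun y hy h0 => ?_, fun y hy z hz hyz => ?_⟩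
  · obtain ⟨x, hx, rfl⟩ := Finset.mem_image.1 hy
    apply h.1 x hx
    rw [← hBA x hx, h0, map_zero]
  · obtain ⟨x, hx, rfl⟩ := Finset.mem_image.1 hy
    obtain ⟨w, hw, rfl⟩ := Finset.mem_image.1 hz
    obtain ⟨a, ha⟩ := Submodule.mem_span_singleton.1 hyz
    rw [h.2 x hx w hw (Submodule.mem_span_singleton.2 ⟨a, ?_⟩)]
    rw [← hBA x hx, ← ha, map_smul, hBA w hw]

lemma exists_le_finrank_eq (W : Submodule k (Fin n → k)) {d : ℕ} (hW : Module.finrank k W ≤ d)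
    (hd : d ≤ n) : ∃ W' : Submodule k (Fin n → k), W ≤ W' ∧ Module.finrank k W' = d := by
  induction d, hW using Nat.le_induction with
  | base => exact ⟨W, le_rfl, rfl⟩
  | succ d _ ih =>
    obtain ⟨W', hWW', hW'⟩ := ih (by omega)
    have hne : W' ≠ ⊤ := by
      rintro rfl
      rw [finrank_top, Module.finrank_fin_fun] at hW'
      omega
    obtain ⟨y, -, hy⟩ := SetLike.exists_of_lt hne.lt_top
    exact ⟨W' ⊔ Submodule.span k {y}, hWW'.trans le_sup_left, by
      rw [Submodule.finrank_sup_span_singleton hy, hW']⟩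

variable {r : ℕ}

lemma rep_injective : Function.Injective (Projectivization.rep : PSpace k r → Fin (r + 1) → k) :=
  fun a b h => by
    rw [← a.mk_rep, ← b.mk_rep]
    congr

lemma distinct_image_rep (S : Finset (PSpace k r)) :
    Distinct (S.image Projectivization.rep) := by
  refine ⟨fun x hx => ?_, fun x hx y hy hxy => ?_⟩
  · obtain ⟨a, -, rfl⟩ := Finset.mem_image.1 hx
    exact a.rep_nonzero
  · obtain ⟨a, -, rfl⟩ := Finset.mem_image.1 hx
    obtain ⟨b, -, rfl⟩ := Finset.mem_image.1 hy
    rw [← Projectivization.submodule_eq] at hxy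
    obtain ⟨c, hc⟩ := Submodule.mem_span_singleton.1 (Projectivization.submodule_eq b ▸ hxy)
    congr 1
    rw [← a.mk_rep, ← b.mk_rep, Projectivization.mk_eq_mk_iff']
    exact ⟨c, hc⟩

/-- Linked points contain fully linked representatives. -/
lemma IsLinked.exists_fullyLinked {ι : Type*} [Fintype ι] {m : ℕ} {P : ι → PSpace k r}
    (hP : Function.Injective P) (h : IsLinked m P) :
    ∃ I : Finset ι, I.Nonempty ∧ FullyLinked m (I.image fun i => (P i).rep) := by
  unfold IsLinked IsGeneral at h
  obtain ⟨g, hg, i₀, hi₀⟩ := Fintype.not_linearIndependent_iff.1 h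
  have hinj : Function.Injective fun i => (P i).rep := rep_injective.comp hP
  refine ⟨Finset.univ.filter fun i => g i ≠ 0, ⟨i₀, by simpa using hi₀⟩,
    Function.extend (fun i => (P i).rep) (fun i => g i / firstCoord (P i).rep ^ m) 0,
    fun x hx => ?_, fun f hf => ?_⟩
  · obtain ⟨i, hi, rfl⟩ := Finset.mem_image.1 hx
    rw [hinj.extend_apply]
    exact div_ne_zero (Finset.mem_filter.1 hi).2
      (pow_ne_zero _ (firstCoord_ne_zero _ (P i).rep_nonzero))
  · rw [Finset.sum_image hinj.injOn]
    have h1 := LinearMap.congr_fun hg ⟨f, hf⟩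
    simp only [LinearMap.sum_apply, LinearMap.smul_apply, LinearMap.zero_apply] at h1
    refine Eq.trans ?_ h1
    rw [Finset.sum_filter]
    refine Finset.sum_congr rfl fun i _ => ?_
    rw [hinj.extend_apply]
    by_cases h0 : g i = 0
    · simp [h0]
    · rw [if_pos h0, smul_eq_mul]
      change _ = g i * (eval (P i).rep f / firstCoord (P i).rep ^ m)
      ring

/-- A bound for the subsets of a family of points contained in some locus bounds the number of
representatives in this locus. -/
lemma card_filter_image_rep_le {ι : Type*} [Fintype ι] {P : ι → PSpace k r} {t : ℕ}
    (I : Finset ι) (q : (Fin (r + 1) → k) → Prop) [DecidablePred q]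
    (h : ∀ J : Finset ι, J.card = t + 1 → ¬ ∀ i ∈ J, q (P i).rep) :
    ((I.image fun i => (P i).rep).filter q).card ≤ t := by
  by_contra! hlt
  rw [Finset.filter_image] at hlt
  obtain ⟨J, hJ, hJt⟩ := Finset.exists_subset_card_eq
    (Nat.succ_le_of_lt hlt |>.trans Finset.card_image_le)
  exact h J hJt fun i hi => (Finset.mem_filter.1 (hJ hi)).2

end Transport

end LinkedPoints

open LinkedPoints

theorem proposition9p1 {k : Type*} [Field k] [IsAlgClosed k] (r m : ℕ) (hr : 2 ≤ r) (hm : 3 ≤ m)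
    (P : Fin (3 * m) → PSpace k r) (hP : Function.Injective P)
    (hlinked : IsLinked m P)
    (hline : ∀ I : Finset (Fin (3 * m)), I.card = m + 2 →
      ¬ AreCollinear (P '' (I : Set (Fin (3 * m)))))
    (hconic : ∀ I : Finset (Fin (3 * m)), I.card = 2 * m + 2 →
      ¬ OnPlaneConic (P '' (I : Set (Fin (3 * m))))) :
    ∃ W : Submodule k (Fin (r + 1) → k), Module.finrank k W = 3 ∧
      Set.range P ⊆ linearSubspace W ∧
      ∃ (φ : W ≃ₗ[k] (Fin 3 → k)) (F G : MvPolynomial (Fin 3) k),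
        F.IsHomogeneous 3 ∧ F ≠ 0 ∧ G.IsHomogeneous m ∧ G ≠ 0 ∧ NoCommonComponent F G ∧
        Set.range P = planeCurve φ F ∩ planeCurve φ G := by
  classical
  obtain ⟨I, ⟨i₀, hi₀⟩, hX⟩ := hlinked.exists_fullyLinked hP
  have hinj : Function.Injective fun i => (P i).rep := rep_injective.comp hP
  have hdist : ∀ J : Finset (Fin (3 * m)), Distinct (J.image fun i => (P i).rep) := fun J => by
    have := distinct_image_rep (J.image P)
    rwa [Finset.image_image] at this
  have hI : I.card ≤ 3 * m := (Finset.card_le_univ I).trans (by simp)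
  have hXcard : (I.image fun i => (P i).rep).card = I.card := Finset.card_image_of_injective _ hinj
  have hlineX : ∀ L : Submodule k (Fin (r + 1) → k), Module.finrank k L ≤ 2 →
      ((I.image fun i => (P i).rep).filter fun x => x ∈ L).card ≤ m + 1 := by
    intro L hL
    refine card_filter_image_rep_le I _ fun J hJ hJL => hline J hJ ?_
    obtain ⟨L', hLL', hL'⟩ := exists_le_finrank_eq L hL (by omega)
    refine ⟨L', hL', ?_⟩
    rintro _ ⟨i, hi, rfl⟩
    change (P i).submodule ≤ L'
    rw [Projectivization.submodule_eq, Submodule.span_singleton_le_iff_mem]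
    exact hLL' (hJL i hi)
  obtain ⟨W₀, hW₀, hXW₀⟩ := hX.coplanar (by omega) (hdist I) (by omega) hlineX
  obtain ⟨W, hW₀W, hW⟩ := exists_le_finrank_eq W₀ hW₀ (show 3 ≤ r + 1 by omega)
  let φ : W ≃ₗ[k] (Fin 3 → k) := LinearEquiv.ofFinrankEq _ _ (by rw [hW, Module.finrank_fin_fun])
  obtain ⟨A, hA⟩ := LinearMap.exists_extend φ.toLinearMap
  have hAφ : ∀ x (hx : x ∈ W), A x = φ ⟨x, hx⟩ := fun x hx => LinearMap.congr_fun hA ⟨x, hx⟩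
  let B : (Fin 3 → k) →ₗ[k] (Fin (r + 1) → k) := W.subtype ∘ₗ φ.symm.toLinearMap
  have hBA : ∀ x ∈ W, B (A x) = x := fun x hx => by simp [B, hAφ x hx]
  have hXW : ∀ x ∈ I.image (fun i => (P i).rep), x ∈ W := fun x hx => hW₀W (hXW₀ x hx)
  set X := I.image fun i => (P i).rep with hXdef
  have hY := hX.image A B fun x hx => hBA x (hXW x hx)
  have hYdist := (hdist I).image A B fun x hx => hBA x (hXW x hx)
  have hYcard : (X.image A).card = X.card := Finset.card_image_of_injOn fun x hx y hy hxy => by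
    rw [← hBA x (hXW x hx), hxy, hBA y (hXW y hy)]
  obtain ⟨hcard, F, G, hF, hF0, hG, hG0, hFG, hFGY⟩ :=
    hY.exists_complete_intersection (by omega) hYdist (by omega) (fun L hL => by
      rw [Finset.filter_image]
      refine Finset.card_image_le.trans (le_trans (Finset.card_le_card ?_)
        (hlineX (L.map B) ((Submodule.finrank_map_le B L).trans hL)))
      intro x hx
      rw [Finset.mem_filter] at hx ⊢
      exact ⟨hx.1, A x, hx.2, hBA x (hXW x hx.1)⟩) (fun Q hQ hQ0 => by
      rw [Finset.filter_image]
      refine Finset.card_image_le.trans (le_trans (Finset.card_le_card ?_)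
        (card_filter_image_rep_le (P := P) I (fun x => x ∈ W ∧ MvPolynomial.eval (A x) Q = 0) ?_))
      · intro x hx
        rw [Finset.mem_filter] at hx ⊢
        exact ⟨hx.1, hXW x hx.1, hx.2⟩
      · intro J hJ hJQ
        refine hconic J hJ ⟨W, φ, Q, hQ, hQ0, ?_⟩
        rintro _ ⟨i, hi, rfl⟩
        obtain ⟨h1, h2⟩ := hJQ i hi
        exact ⟨h1, hAφ _ h1 ▸ h2⟩) ⟨_, Finset.mem_image_of_mem A (Finset.mem_image_of_mem _ hi₀)⟩
  have hIuniv : I = Finset.univ :=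
    Finset.eq_univ_of_card I (by rw [← hXcard, ← hYcard, hcard, Fintype.card_fin])
  have hPX : ∀ i, (P i).rep ∈ X := fun i =>
    Finset.mem_image_of_mem _ (hIuniv ▸ Finset.mem_univ i)
  refine ⟨W, hW, ?_, φ, F, G, hF, hF0, hG, hG0, fun H hH hHF hHG => hH.not_isUnit (hFG hHF hHG),
    Set.Subset.antisymm ?_ ?_⟩
  · rintro _ ⟨i, rfl⟩
    change (P i).submodule ≤ W
    rw [Projectivization.submodule_eq, Submodule.span_singleton_le_iff_mem]
    exact hXW _ (hPX i)
  · rintro _ ⟨i, rfl⟩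
    have h1 := hXW _ (hPX i)
    obtain ⟨h2, h3⟩ := hFGY _ (Finset.mem_image_of_mem A (hPX i))
    rw [hAφ _ h1] at h2 h3
    exact ⟨⟨h1, h2⟩, ⟨h1, h3⟩⟩
  · -- A further common point would contradict the bound for the number of common points.
    rintro q ⟨⟨hqW, hqF⟩, ⟨_, hqG⟩⟩
    by_contra hq
    rw [← hAφ _ hqW] at hqF hqG
    have hqX : q.rep ∉ X := fun hmem => by
      obtain ⟨i, -, hi⟩ := Finset.mem_image.1 hmem
      exact hq ⟨i, rep_injective hi⟩
    have hZW : ∀ x ∈ insert q.rep X, x ∈ W := fun x hx => by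
      rcases Finset.mem_insert.1 hx with rfl | hx
      · exact hqW
      · exact hXW x hx
    have hZdist : Distinct (insert q.rep X) := by
      have := distinct_image_rep (insert q (I.image P))
      rwa [Finset.image_insert, Finset.image_image] at this
    have hZ := hZdist.image A B fun x hx => hBA x (hZW x hx)
    have hZcard : ((insert q.rep X).image A).card = X.card + 1 := by
      rw [Finset.card_image_of_injOn, Finset.card_insert_of_notMem hqX]
      intro x hx y hy hxy
      rw [← hBA x (hZW x hx), hxy, hBA y (hZW y hy)]
    have hvan : ∀ z ∈ (insert q.rep X).image A,
        MvPolynomial.eval z F = 0 ∧ MvPolynomial.eval z G = 0 := by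
      intro z hz
      rw [Finset.image_insert, Finset.mem_insert] at hz
      rcases hz with rfl | hz
      · exact ⟨hqF, hqG⟩
      · exact hFGY z hz
    have := card_le_mul_of_isRelPrime hZ hF hG hG0 hFG (fun z hz => (hvan z hz).1)
      fun z hz => (hvan z hz).2
    omega
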